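/- **Setting.** Fix integers $n,k,d\ge 0$, a set $\mathcal T$, and a probability density $p_\varepsilon$ on $\mathbb R^d$. A parameter $\theta=(f,H,\lambda)$ consists of a measurable mixing function $f:\mathbb R^n\to\mathbb R^d$, measurable sufficient statistics $H_{i,j}:\mathbb R\to\mathbb R$ ($1\le i\le n$, $1\le j\le k$), and an arbitrary function $\lambda=(\lambda_{i,j}):\mathcal T\to\mathbb R^{nk}$. It comes with measurable base functions $Q_i:\mathbb R\to[0,\infty)$, which may differ from one parameter to another. It is assumed that $Z_i(t)=\int_{\mathbb R} Q_i(s)\exp\big(\sum_{j}H_{i,j}(s)\lambda_{i,j}(t)\big)\,ds\in(0,\infty)$ for all $i$ and $t$. The conditional generative model of $\theta$ is $$p_\theta(x,m\mid t)=p_\varepsilon(x-f(m))\,p_{H,\lambda}(m\mid t),\qquad p_{H,\lambda}(m\mid t)=\prod_{i=1}^n\frac{Q_i(m_i)}{Z_i(t)}\exp\Big(\sum_{j=1}^k H_{i,j}(m_i)\lambda_{i,j}(t)\Big),$$ and the observed density is $p_\theta(x\mid t)=\int_{\mathbb R^n} p_\theta(x,m\mid t)\,dm$. Write $\mathcal M_i=\{s: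 Q_i(s)>0\}$, $\mathcal M=\prod_i\mathcal M_i$ and $H(m)=(H_{i,j}(m_i))_{i,j}\in\mathbb R^{nk}$. Let $\mu_\theta$ be the image under $f$ of Lebesgue measure on $\mathcal M$; it has the same null sets as the law of $f(M)$ given $t$, for every $t$. Let $\Theta$ be the set of parameters for which $f$ is injective on $\mathcal M$, and write $f^{-1}:f(\mathcal M)\to\mathcal M$ for the inverse. **Theorem.** Let $\theta=(f,H,\lambda)$ be a parameter such that 1. $f$ is injective on $\mathcal M$; 2. the characteristic function $\varphi_\varepsilon$ of the density $p_\varepsilon$ vanishes only on a Lebesgue null set of $\mathbb R^d$; 3. each $H_{i,j}$ is differentiable at almost every point of $\mathcal M_i$, and for each $i$ no nontrivial linear combination of $H_{i,1},\dots,H_{i,k}$ is constant on a measurable subset of $\mathcal M_i$ of positive measure; 4. there are $nk+1$ distinct points $T_0,\dots,T_{nk}\in\mathcal T$ such that the $nk\times nk$ matrix $L=(\lambda(T_1)-\lambda(T_0),\dots,\lambda(T_{nk})-\lambda(T_0))$ is invertible. Then $\theta$ is $\sim_A$-identifiable. That is, for every $\hat\theta=(\hat f,\hat H,\hat\lambda)\in\Theta$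 such that, for every $t\in\mathcal T$, $p_\theta(x\mid t)=p_{\hat\theta}(x\mid t)$ for almost every $x\in\mathbb R^d$, the measures $\mu_\theta$ and $\mu_{\hat\theta}$ have the same null sets, and there are an invertible matrix $A\in\mathbb R^{nk\times nk}$ and a vector $c\in\mathbb R^{nk}$ with $$H(f^{-1}(x))=A\,\hat H(\hat f^{-1}(x))+c$$ for $\mu_\theta$-almost every $x$. (Almost every such $x$ lies in $f(\mathcal M)\cap\hat f(\hat{\mathcal M})$.) If moreover $\theta$ and $\hat\theta$ are both regular, then $A$ and $c$ can be chosen so that the identity holds for every $x\in f(\mathcal M)\cap\hat f(\hat{\mathcal M})$. Here a parameter is called regular if its latent space $\mathcal M$ is open, its mixing function is a homeomorphism from $\mathcal M$ onto its image, and each $H_{i,j}$ is continuous on $\mathcal M_i$. -/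

import Mathlib

open MeasureTheory Set

noncomputable section

/-- The data of one conditional generative model `p(x, m | t) = p_ε(x - f(m)) p_{H,λ}(m | t)`
with `n` latent coordinates, `k` sufficient statistics per latent coordinate, observations in
`ℝ^d`, and conditioning variable `t : 𝒯`. The base functions `Q i` are kept with the parameters
`(f, H, λ)`, so that two parameters may come with different base functions. -/
structure Params (n k d : ℕ) (𝒯 : Type*) where
  /-- mixing function -/
  f : (Fin n → ℝ) → EuclideanSpace ℝ (Fin d)
  /-- base functions -/
  Q : Fin n → ℝ → ℝ
  /-- sufficient statistics -/
  H : Fin n → Fin k → ℝ → ℝ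
  /-- natural parameters, as functions of the conditioning variable -/
  lam : 𝒯 → Fin n → Fin k → ℝ

/-- `p` is a probability density on `ℝ^d` with respect to Lebesgue measure. -/
structure IsProbDensity {d : ℕ} (p : EuclideanSpace ℝ (Fin d) → ℝ) : Prop where
  measurable : Measurable p
  nonneg : ∀ x, 0 ≤ p x
  lintegral_eq_one : ∫⁻ x, ENNReal.ofReal (p x) = 1

/-- The characteristic function of the distribution with density `p`. -/
def noiseCharFun {d : ℕ} (p : EuclideanSpace ℝ (Fin d) → ℝ) :
    EuclideanSpace ℝ (Fin d) → ℂ :=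
  charFun (volume.withDensity fun x => ENNReal.ofReal (p x))

namespace Params

variable {n k d : ℕ} {𝒯 : Type*}

/-- The unnormalised density `Q_i(s) exp(∑_j H_{i,j}(s) λ_{i,j}(t))` of one latent coordinate. -/
def weight (θ : Params n k d 𝒯) (t : 𝒯) (i : Fin n) (s : ℝ) : ℝ :=
  θ.Q i s * Real.exp (∑ j, θ.H i j s * θ.lam t i j)

/-- The normalising constant `Z_i(t)`. -/
def normConst (θ : Params n k d 𝒯) (t : 𝒯) (i : Fin n) : ℝ :=
  ∫ s, θ.weight t i s

/-- The conditionally factorial exponential family density `p_{H,λ}(m | t)`. -/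
def prior (θ : Params n k d 𝒯) (t : 𝒯) (m : Fin n → ℝ) : ℝ :=
  ∏ i, θ.Q i (m i) / θ.normConst t i * Real.exp (∑ j, θ.H i j (m i) * θ.lam t i j)

/-- The joint density `p_θ(x, m | t) = p_ε(x - f(m)) p_{H,λ}(m | t)`. -/
def jointDensity (pε : EuclideanSpace ℝ (Fin d) → ℝ) (θ : Params n k d 𝒯) (t : 𝒯)
    (x : EuclideanSpace ℝ (Fin d)) (m : Fin n → ℝ) : ℝ :=
  pε (x - θ.f m) * θ.prior t m

/-- The density `p_θ(x | t) = ∫ p_θ(x, m | t) dm` of the observed variable. -/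
def obsDensity (pε : EuclideanSpace ℝ (Fin d) → ℝ) (θ : Params n k d 𝒯) (t : 𝒯)
    (x : EuclideanSpace ℝ (Fin d)) : ENNReal :=
  ∫⁻ m, ENNReal.ofReal (jointDensity pε θ t x m)

/-- The range `{s | Q_i(s) > 0}` of the `i`-th latent coordinate. -/
def latentAxis (θ : Params n k d 𝒯) (i : Fin n) : Set ℝ := {s | 0 < θ.Q i s}

/-- The latent space `∏_i {s | Q_i(s) > 0}`, on which the prior densities are positive. -/
def latentSpace (θ : Params n k d 𝒯) : Set (Fin n → ℝ) := {m | ∀ i, m i ∈ θ.latentAxis i}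

/-- The formulas define a genuine model: everything is measurable, the base functions are
nonnegative, and every normalising constant is finite and positive. -/
structure IsModel (θ : Params n k d 𝒯) : Prop where
  measurable_f : Measurable θ.f
  measurable_Q : ∀ i, Measurable (θ.Q i)
  measurable_H : ∀ i j, Measurable (θ.H i j)
  Q_nonneg : ∀ i s, 0 ≤ θ.Q i s
  integrable_weight : ∀ t i, Integrable (θ.weight t i)
  normConst_pos : ∀ t i, 0 < θ.normConst t i

/-- The parameter set `Θ`: models whose mixing function is injective on the latent space
(so that `f⁻¹` makes sense). -/
def admissible (n k d : ℕ) (𝒯 : Type*) : Set (Params n k d 𝒯) :=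
  {θ | θ.IsModel ∧ InjOn θ.f θ.latentSpace}

/-- The image of the latent space under the mixing function. -/
def image (θ : Params n k d 𝒯) : Set (EuclideanSpace ℝ (Fin d)) := θ.f '' θ.latentSpace

/-- The inverse `f⁻¹` of the mixing function, meaningful on `θ.image`. -/
def inv (θ : Params n k d 𝒯) : EuclideanSpace ℝ (Fin d) → (Fin n → ℝ) :=
  Function.invFunOn θ.f θ.latentSpace

/-- The vector `H(m) = (H_{i,j}(m_i))_{i,j}` of length `n k`. -/
def stat (θ : Params n k d 𝒯) (m : Fin n → ℝ) : Fin n × Fin k → ℝ :=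
  fun p => θ.H p.1 p.2 (m p.1)

/-- Lebesgue measure on the latent space, transported by the mixing function. For a model it has
the same null sets as the distribution of `f(M)` given `t`, for every `t`. -/
def imageMeasure (θ : Params n k d 𝒯) : Measure (EuclideanSpace ℝ (Fin d)) :=
  (volume.restrict θ.latentSpace).map θ.f

/-- The images of the two mixing functions agree up to null sets, with the same null sets. -/
def SameNullSets (θ θ' : Params n k d 𝒯) : Prop :=
  θ.imageMeasure ≪ θ'.imageMeasure ∧ θ'.imageMeasure ≪ θ.imageMeasure

/-- `θ ∼_A θ'`: `H(f⁻¹(x)) = A H'(f'⁻¹(x)) + c` for almost every `x` in the image, with `A`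
invertible. -/
def EquivA (θ θ' : Params n k d 𝒯) : Prop :=
  SameNullSets θ θ' ∧
    ∃ (A : Matrix (Fin n × Fin k) (Fin n × Fin k) ℝ) (c : Fin n × Fin k → ℝ),
      IsUnit A ∧
      ∀ᵐ x ∂θ.imageMeasure, θ.stat (θ.inv x) = A.mulVec (θ'.stat (θ'.inv x)) + c

/-- The same relation with the identity at every point where both inverses are defined. -/
def StrictEquivA (θ θ' : Params n k d 𝒯) : Prop :=
  SameNullSets θ θ' ∧
    ∃ (A : Matrix (Fin n × Fin k) (Fin n × Fin k) ℝ) (c : Fin n × Fin k → ℝ),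
      IsUnit A ∧
      ∀ x ∈ θ.image ∩ θ'.image, θ.stat (θ.inv x) = A.mulVec (θ'.stat (θ'.inv x)) + c

/-- `θ` and `θ'` give the same conditional distributions of the observed variable. -/
def SameObserved (pε : EuclideanSpace ℝ (Fin d) → ℝ) (θ θ' : Params n k d 𝒯) : Prop :=
  ∀ t, ∀ᵐ x, obsDensity pε θ t x = obsDensity pε θ' t x

/-- `θ` is identifiable, within the parameter set `Θ`, up to the relation `R`. -/
def IdentifiableUpTo (pε : EuclideanSpace ℝ (Fin d) → ℝ) (Θ : Set (Params n k d 𝒯))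
    (R : Params n k d 𝒯 → Params n k d 𝒯 → Prop) (θ : Params n k d 𝒯) : Prop :=
  ∀ θ' ∈ Θ, SameObserved pε θ θ' → R θ θ'

/-- For each `i`, no nontrivial linear combination of `H_{i,1}, …, H_{i,k}` is constant on a set
of positive measure in the range of the `i`-th latent coordinate. -/
def StronglyIndependent (θ : Params n k d 𝒯) : Prop :=
  ∀ (i : Fin n) (S : Set ℝ), S ⊆ θ.latentAxis i → MeasurableSet S → 0 < volume S →
    ∀ (w : Fin k → ℝ) (c : ℝ), (∀ s ∈ S, ∑ j, w j * θ.H i j s = c) → w = 0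

/-- The `nk × nk` matrix with columns `λ(T_l) - λ(T_0)`, `l = 1, …, nk`. -/
def lamMatrix (θ : Params n k d 𝒯) (T : Fin (n * k + 1) → 𝒯) :
    Matrix (Fin n × Fin k) (Fin n × Fin k) ℝ :=
  Matrix.of fun p l => θ.lam (T (finProdFinEquiv l).succ) p.1 p.2 - θ.lam (T 0) p.1 p.2

/-- The latent space is open, `f` is a homeomorphism from it onto its image, and the sufficient
statistics are continuous. -/
structure Regular (θ : Params n k d 𝒯) : Prop where
  isOpen_latentSpace : IsOpen θ.latentSpace
  continuousOn_f : ContinuousOn θ.f θ.latentSpace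
  continuousOn_inv : ContinuousOn θ.inv θ.image
  continuousOn_H : ∀ i j, ContinuousOn (θ.H i j) (θ.latentAxis i)

end Params

end

/-! Deconvolution removes the noise. The observed law given `t` is the law of `f(M)` convolved with
the noise, so characteristic functions multiply. The noise factor is nonzero almost everywhere and
characteristic functions are continuous, hence both models have the same law of `f(M)` for every `t`
(`SameObserved.signalLaw_eq`).

Comparing `t` with a base point `t₀` then removes the base functions: since `f` is injective, the
law of `f(M)` at `t` has density `const * exp((λ(t) - λ(t₀)) ⬝ᵥ H(f⁻¹(x)))` relative to the law at
`t₀`, with no Jacobian. Uniqueness of densities and logarithms give one affine equation for each `t`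
(`ae_dotProduct_stat_eq`). Taking `t₀ = T 0` and the other `nk` points gives a linear system that
invertibility of `L` solves for `H ∘ f⁻¹`.

Invertibility of the resulting `A` uses only independence of the statistics of `θ`: a left null
vector of `A` would make a nontrivial combination of them constant almost everywhere, and Fubini
isolates one coordinate (`isUnit_of_ae_stat_eq`). In the regular case, continuity extends the
identity from a dense set. -/

/-- Convolving the law of `f` with a density gives the mixture of the translated densities. -/
theorem map_conv_withDensity {d : ℕ} {X : Type*} [MeasurableSpace X] (π : Measure X) [SFinite π]
    {f : X → EuclideanSpace ℝ (Fin d)} (hf : Measurable f)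
    {p : EuclideanSpace ℝ (Fin d) → ENNReal} (hp : Measurable p) :
    (π.map f).conv (volume.withDensity p) =
      volume.withDensity fun x => ∫⁻ m, p (x - f m) ∂π := by
  ext s hs
  have hind : Measurable (s.indicator (1 : EuclideanSpace ℝ (Fin d) → ENNReal)) :=
    measurable_one.indicator hs
  rw [← lintegral_indicator_one hs, Measure.lintegral_conv hind, withDensity_apply _ hs,
    lintegral_map (Measurable.lintegral_prod_right (by fun_prop)) hf,
    ← lintegral_indicator hs]
  have key : ∀ m, ∫⁻ y, s.indicator 1 (f m + y) ∂volume.withDensity p =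
      ∫⁻ x, s.indicator 1 x * p (x - f m) := by
    intro m
    rw [lintegral_withDensity_eq_lintegral_mul _ hp (by fun_prop),
      ← lintegral_sub_right_eq_self _ (f m)]
    refine lintegral_congr fun x => ?_
    simp [mul_comm]
  simp_rw [key]
  rw [lintegral_lintegral_swap (by fun_prop)]
  refine lintegral_congr fun x => ?_
  by_cases hx : x ∈ s <;> simp [hx]

/-- Convolution with a finite measure whose characteristic function is almost everywhere nonzero
can be cancelled. -/
theorem eq_of_conv_eq_conv {d : ℕ} {μ ν N : Measure (EuclideanSpace ℝ (Fin d))}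
    [IsFiniteMeasure μ] [IsFiniteMeasure ν] [IsFiniteMeasure N]
    (hN : volume {x | charFun N x = 0} = 0) (h : μ.conv N = ν.conv N) : μ = ν := by
  refine Measure.ext_of_charFun ?_
  -- Lebesgue measure charges every nonempty open set, so continuous functions that agree almost
  -- everywhere are equal.
  refine Continuous.ae_eq_iff_eq volume continuous_charFun continuous_charFun |>.1 ?_
  have hN' : ∀ᵐ x, charFun N x ≠ 0 := by simpa [ae_iff] using hN
  filter_upwards [hN'] with x hx
  have := congrArg (fun ρ => charFun ρ x) h
  simp only [charFun_conv] at this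
  exact mul_right_cancel₀ hx this

/-- If a sum of functions of separate coordinates is almost everywhere constant on a box with
sides of positive measure, then each summand is almost everywhere constant on its side. -/
theorem ae_const_of_ae_sum_const {n : ℕ} {s : Fin n → Set ℝ} (hs : ∀ i, volume (s i) ≠ 0)
    {h : Fin n → ℝ → ℝ} {c : ℝ}
    (hh : ∀ᵐ m : Fin n → ℝ, (∀ i, m i ∈ s i) → ∑ i, h i (m i) = c) (i : Fin n) :
    ∃ c', ∀ᵐ x, x ∈ s i → h i x = c' := by
  obtain _ | n := n
  · exact i.elim0
  -- The swap puts coordinate `i` last: Fubini then gives, for almost every choice `y` of the other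
  -- coordinates, the identity for almost every value of coordinate `i`.
  have mp := ((volume_preserving_piFinSuccAbove (fun _ : Fin (n + 1) => ℝ) i).symm _).comp
    (Measure.measurePreserving_swap (μ := (volume : Measure (Fin n → ℝ)))
      (ν := (volume : Measure ℝ)))
  have h1 := Measure.ae_ae_of_ae_prod (mp.quasiMeasurePreserving.ae hh)
  have hpos : volume (Set.univ.pi fun j => s (i.succAbove j)) ≠ 0 := by
    rw [volume_pi_pi]
    exact Finset.prod_ne_zero_iff.2 fun j _ => hs _
  obtain ⟨y, hy, hy'⟩ := ((frequently_ae_mem_iff.2 hpos).and_eventually h1).exists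
  refine ⟨c - ∑ j, h (i.succAbove j) (y j), ?_⟩
  filter_upwards [hy'] with x hx hxs
  have hval : (MeasurableEquiv.piFinSuccAbove (fun _ : Fin (n + 1) => ℝ) i).symm (x, y) =
      i.insertNth x y := rfl
  simp only [Function.comp_apply, Prod.swap_prod_mk, hval] at hx
  have := hx (by
    rw [i.forall_iff_succAbove]
    simpa using ⟨hxs, fun j => hy j (mem_univ _)⟩)
  rw [Fin.sum_univ_succAbove _ i] at this
  simp only [Fin.insertNth_apply_same, Fin.insertNth_apply_succAbove] at this
  linarith

/-- Reweighting by `r` commutes with a map that has a left inverse `g` almost everywhere. -/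
theorem map_withDensity_of_leftInverse {X Y : Type*} [MeasurableSpace X] [MeasurableSpace Y]
    {π : Measure X} {f : X → Y} {g : Y → X} {r : X → ENNReal} (hf : Measurable f)
    (hg : Measurable g) (hr : Measurable r) (hgf : ∀ᵐ m ∂π, g (f m) = m) :
    (π.withDensity r).map f = (π.map f).withDensity (r ∘ g) := by
  ext s hs
  rw [Measure.map_apply hf hs, withDensity_apply _ (hf hs), withDensity_apply _ hs,
    setLIntegral_map hs (hr.comp hg) hf]
  refine setLIntegral_congr_fun_ae (hf hs) ?_
  filter_upwards [hgf] with m hm _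
  simp [hm]

/-! ### Laws of the latent variable and of the noiseless observation -/

namespace Params

variable {n k d : ℕ} {𝒯 : Type*} {θ θ' : Params n k d 𝒯}

theorem prior_eq_prod_weight (θ : Params n k d 𝒯) (t : 𝒯) (m : Fin n → ℝ) :
    θ.prior t m = ∏ i, θ.weight t i (m i) / θ.normConst t i := by
  refine Finset.prod_congr rfl fun i _ => ?_
  rw [weight]
  ring

theorem IsModel.measurableSet_latentAxis (hθ : θ.IsModel) (i : Fin n) :
    MeasurableSet (θ.latentAxis i) :=
  measurableSet_lt measurable_const (hθ.measurable_Q i)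

theorem IsModel.measurableSet_latentSpace (hθ : θ.IsModel) : MeasurableSet θ.latentSpace := by
  have : θ.latentSpace = ⋂ i, (fun m : Fin n → ℝ => m i) ⁻¹' θ.latentAxis i := by
    ext m; simp [latentSpace]
  rw [this]
  exact .iInter fun i => measurable_pi_apply i (hθ.measurableSet_latentAxis i)

theorem IsModel.measurable_weight (hθ : θ.IsModel) (t : 𝒯) (i : Fin n) :
    Measurable (θ.weight t i) := by
  have := hθ.measurable_Q i
  have := hθ.measurable_H i
  unfold weight
  fun_prop

theorem IsModel.measurable_prior (hθ : θ.IsModel) (t : 𝒯) : Measurable (θ.prior t) := by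
  have := hθ.measurable_weight t
  simp_rw [funext (θ.prior_eq_prod_weight t)]
  fun_prop

theorem IsModel.integrable_prior (hθ : θ.IsModel) (t : 𝒯) : Integrable (θ.prior t) := by
  simp_rw [funext (θ.prior_eq_prod_weight t)]
  exact Integrable.fintype_prod fun i => (hθ.integrable_weight t i).div_const _

theorem IsModel.prior_pos_iff (hθ : θ.IsModel) (t : 𝒯) (m : Fin n → ℝ) :
    0 < θ.prior t m ↔ m ∈ θ.latentSpace := by
  constructor
  · intro h i
    refine (hθ.Q_nonneg i (m i)).lt_of_ne fun h0 => h.ne' ?_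
    exact Finset.prod_eq_zero (Finset.mem_univ i) (by simp [← h0])
  · intro h
    exact Finset.prod_pos fun i _ =>
      mul_pos (div_pos (h i) (hθ.normConst_pos t i)) (Real.exp_pos _)

theorem IsModel.prior_nonneg (hθ : θ.IsModel) (t : 𝒯) (m : Fin n → ℝ) : 0 ≤ θ.prior t m :=
  Finset.prod_nonneg fun i _ =>
    mul_nonneg (div_nonneg (hθ.Q_nonneg i _) (hθ.normConst_pos t i).le) (Real.exp_pos _).le

theorem IsModel.volume_latentAxis_ne_zero (hθ : θ.IsModel) (t : 𝒯) (i : Fin n) :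
    volume (θ.latentAxis i) ≠ 0 := by
  intro h0
  refine (hθ.normConst_pos t i).ne' (integral_eq_zero_of_ae ?_)
  have : ∀ᵐ s, s ∉ θ.latentAxis i := measure_eq_zero_iff_ae_notMem.1 h0
  filter_upwards [this] with s hs
  have : θ.Q i s = 0 := le_antisymm (not_lt.1 hs) (hθ.Q_nonneg i s)
  simp [weight, this]

/-- The law of the latent variable given `t`. -/
noncomputable def latentLaw (θ : Params n k d 𝒯) (t : 𝒯) : Measure (Fin n → ℝ) :=
  volume.withDensity fun m => ENNReal.ofReal (θ.prior t m)

/-- The law of the noiseless observation `f(M)` given `t`. -/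
noncomputable def signalLaw (θ : Params n k d 𝒯) (t : 𝒯) : Measure (EuclideanSpace ℝ (Fin d)) :=
  (θ.latentLaw t).map θ.f

theorem IsModel.isFiniteMeasure_latentLaw (hθ : θ.IsModel) (t : 𝒯) :
    IsFiniteMeasure (θ.latentLaw t) :=
  isFiniteMeasure_withDensity_ofReal (hθ.integrable_prior t).2

theorem IsModel.isFiniteMeasure_signalLaw (hθ : θ.IsModel) (t : 𝒯) :
    IsFiniteMeasure (θ.signalLaw t) := by
  have := hθ.isFiniteMeasure_latentLaw t
  unfold signalLaw
  infer_instance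

/-- The prior is positive exactly on the latent space, whatever `t` is, so its null sets do not
depend on `t`. -/
theorem IsModel.ae_latentLaw (hθ : θ.IsModel) (t : 𝒯) :
    ae (θ.latentLaw t) = ae (volume.restrict θ.latentSpace) := by
  ext s
  change (∀ᵐ m ∂_, m ∈ s) ↔ (∀ᵐ m ∂_, m ∈ s)
  rw [latentLaw, ae_withDensity_iff (hθ.measurable_prior t).ennreal_ofReal,
    ae_restrict_iff' hθ.measurableSet_latentSpace]
  simp only [ne_eq, ENNReal.ofReal_eq_zero, not_le, hθ.prior_pos_iff]

theorem IsModel.imageMeasure_ac_signalLaw (hθ : θ.IsModel) (t : 𝒯) :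
    θ.imageMeasure ≪ θ.signalLaw t :=
  (Measure.ae_le_iff_absolutelyContinuous.1 (hθ.ae_latentLaw t).ge).map hθ.measurable_f

theorem IsModel.signalLaw_ac_imageMeasure (hθ : θ.IsModel) (t : 𝒯) :
    θ.signalLaw t ≪ θ.imageMeasure :=
  (Measure.ae_le_iff_absolutelyContinuous.1 (hθ.ae_latentLaw t).le).map hθ.measurable_f

theorem IsModel.conv_signalLaw (hθ : θ.IsModel) {pε : EuclideanSpace ℝ (Fin d) → ℝ}
    (hpε : IsProbDensity pε) (t : 𝒯) :
    (θ.signalLaw t).conv (volume.withDensity fun x => ENNReal.ofReal (pε x)) =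
      volume.withDensity (obsDensity pε θ t) := by
  have := hθ.isFiniteMeasure_latentLaw t
  rw [signalLaw, map_conv_withDensity _ hθ.measurable_f hpε.measurable.ennreal_ofReal]
  congr 1
  ext x
  have := hpε.measurable
  have := hθ.measurable_f
  rw [latentLaw, lintegral_withDensity_eq_lintegral_mul _
    (hθ.measurable_prior t).ennreal_ofReal (by fun_prop)]
  refine lintegral_congr fun m => ?_
  rw [Pi.mul_apply, ← ENNReal.ofReal_mul (hθ.prior_nonneg t m), mul_comm, jointDensity]

theorem SameObserved.signalLaw_eq {pε : EuclideanSpace ℝ (Fin d) → ℝ}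
    (h : SameObserved pε θ θ') (hpε : IsProbDensity pε)
    (hchar : volume {x | noiseCharFun pε x = 0} = 0) (hθ : θ.IsModel) (hθ' : θ'.IsModel)
    (t : 𝒯) : θ.signalLaw t = θ'.signalLaw t := by
  have := hθ.isFiniteMeasure_signalLaw t
  have := hθ'.isFiniteMeasure_signalLaw t
  have : IsFiniteMeasure (volume.withDensity fun x => ENNReal.ofReal (pε x)) :=
    ⟨by simp [hpε.lintegral_eq_one]⟩
  refine eq_of_conv_eq_conv hchar ?_
  rw [hθ.conv_signalLaw hpε, hθ'.conv_signalLaw hpε, withDensity_congr_ae (h t)]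

/-! ### Image and inverse of the mixing function -/

theorem IsModel.measurableSet_image (hθ : θ.IsModel) (hinj : InjOn θ.f θ.latentSpace) :
    MeasurableSet θ.image :=
  hθ.measurableSet_latentSpace.image_of_measurable_injOn hθ.measurable_f hinj

theorem ae_mem_image (hθ : θ.IsModel) (hinj : InjOn θ.f θ.latentSpace) :
    ∀ᵐ x ∂θ.imageMeasure, x ∈ θ.image := by
  refine (ae_map_iff (p := (· ∈ θ.image)) hθ.measurable_f.aemeasurable
    (hθ.measurableSet_image hinj)).2 ?_
  filter_upwards [ae_restrict_mem hθ.measurableSet_latentSpace] with m hm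
  exact mem_image_of_mem _ hm

theorem inv_apply (hinj : InjOn θ.f θ.latentSpace) {m : Fin n → ℝ} (hm : m ∈ θ.latentSpace) :
    θ.inv (θ.f m) = m :=
  hinj.leftInvOn_invFunOn hm

theorem inv_mem {x : EuclideanSpace ℝ (Fin d)} (hx : x ∈ θ.image) : θ.inv x ∈ θ.latentSpace :=
  Function.invFunOn_mem hx

/-- By Lusin–Souslin, an injective Borel map on a standard Borel space is a measurable embedding, so
its inverse extends to a measurable map. -/
theorem IsModel.exists_measurable_inv (hθ : θ.IsModel) (hinj : InjOn θ.f θ.latentSpace) :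
    ∃ g : EuclideanSpace ℝ (Fin d) → (Fin n → ℝ), Measurable g ∧
      ∀ m ∈ θ.latentSpace, g (θ.f m) = m := by
  have := hθ.measurableSet_latentSpace.standardBorel
  have he : MeasurableEmbedding fun m : θ.latentSpace => θ.f m :=
    (hθ.measurable_f.comp measurable_subtype_coe).measurableEmbedding
      fun a b hab => Subtype.ext (hinj a.2 b.2 hab)
  obtain ⟨g, hg, hgf⟩ := he.exists_measurable_extend measurable_subtype_coe fun _ => inferInstance
  exact ⟨g, hg, fun m hm => congrFun hgf ⟨m, hm⟩⟩

/-! ### Density ratios and the linear system -/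

/-- The difference of the natural parameters at `t` and `t₀`. -/
noncomputable def lamDiff (θ : Params n k d 𝒯) (t₀ t : 𝒯) (p : Fin n × Fin k) : ℝ :=
  θ.lam t p.1 p.2 - θ.lam t₀ p.1 p.2

/-- The ratio of the normalising constants of the priors at `t₀` and `t`. -/
noncomputable def normRatio (θ : Params n k d 𝒯) (t₀ t : 𝒯) : ℝ :=
  ∏ i, θ.normConst t₀ i / θ.normConst t i

theorem IsModel.normRatio_pos (hθ : θ.IsModel) (t₀ t : 𝒯) : 0 < θ.normRatio t₀ t :=
  Finset.prod_pos fun i _ => div_pos (hθ.normConst_pos t₀ i) (hθ.normConst_pos t i)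

/-- The density of the prior at `t` relative to the prior at `t₀`. -/
noncomputable def priorRatio (θ : Params n k d 𝒯) (t₀ t : 𝒯) (m : Fin n → ℝ) : ℝ :=
  θ.normRatio t₀ t * Real.exp (θ.lamDiff t₀ t ⬝ᵥ θ.stat m)

theorem IsModel.prior_eq_mul_priorRatio (hθ : θ.IsModel) (t₀ t : 𝒯) (m : Fin n → ℝ) :
    θ.prior t m = θ.prior t₀ m * θ.priorRatio t₀ t m := by
  rw [prior, prior, priorRatio, normRatio, dotProduct, Fintype.sum_prod_type, Real.exp_sum,
    ← Finset.prod_mul_distrib, ← Finset.prod_mul_distrib]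
  refine Finset.prod_congr rfl fun i _ => ?_
  have h0 := (hθ.normConst_pos t₀ i).ne'
  have hexp : Real.exp (∑ j, θ.H i j (m i) * θ.lam t i j) =
      Real.exp (∑ j, θ.H i j (m i) * θ.lam t₀ i j) *
        Real.exp (∑ j, θ.lamDiff t₀ t (i, j) * θ.stat m (i, j)) := by
    rw [← Real.exp_add, ← Finset.sum_add_distrib]
    congr 1
    refine Finset.sum_congr rfl fun j _ => ?_
    simp only [lamDiff, stat]
    ring
  rw [hexp]
  field_simp

theorem IsModel.measurable_stat (hθ : θ.IsModel) : Measurable θ.stat :=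
  measurable_pi_iff.2 fun p => (hθ.measurable_H p.1 p.2).comp (measurable_pi_apply p.1)

theorem IsModel.measurable_priorRatio (hθ : θ.IsModel) (t₀ t : 𝒯) :
    Measurable (θ.priorRatio t₀ t) := by
  have h (p : Fin n × Fin k) : Measurable fun m => θ.stat m p :=
    (measurable_pi_apply p).comp hθ.measurable_stat
  unfold priorRatio dotProduct
  fun_prop

theorem IsModel.signalLaw_eq_withDensity (hθ : θ.IsModel)
    {g : EuclideanSpace ℝ (Fin d) → (Fin n → ℝ)} (hg : Measurable g)
    (hgf : ∀ m ∈ θ.latentSpace, g (θ.f m) = m) (t₀ t : 𝒯) :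
    θ.signalLaw t =
      (θ.signalLaw t₀).withDensity fun x => ENNReal.ofReal (θ.priorRatio t₀ t (g x)) := by
  have hlat : θ.latentLaw t =
      (θ.latentLaw t₀).withDensity fun m => ENNReal.ofReal (θ.priorRatio t₀ t m) := by
    rw [latentLaw, latentLaw, ← withDensity_mul _ (hθ.measurable_prior t₀).ennreal_ofReal
      (hθ.measurable_priorRatio t₀ t).ennreal_ofReal]
    congr 1
    ext m
    rw [Pi.mul_apply, ← ENNReal.ofReal_mul (hθ.prior_nonneg t₀ m),
      hθ.prior_eq_mul_priorRatio t₀ t]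
  rw [signalLaw, hlat, map_withDensity_of_leftInverse hθ.measurable_f hg
    (hθ.measurable_priorRatio t₀ t).ennreal_ofReal]
  · rfl
  · rw [Filter.Eventually, hθ.ae_latentLaw]
    filter_upwards [ae_restrict_mem hθ.measurableSet_latentSpace] with m hm using hgf m hm

theorem sameNullSets_of_signalLaw_eq (hθ : θ.IsModel) (hθ' : θ'.IsModel) {t : 𝒯}
    (h : θ.signalLaw t = θ'.signalLaw t) : SameNullSets θ θ' :=
  ⟨(hθ.imageMeasure_ac_signalLaw t).trans (h ▸ hθ'.signalLaw_ac_imageMeasure t),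
    (hθ'.imageMeasure_ac_signalLaw t).trans (h ▸ hθ.signalLaw_ac_imageMeasure t)⟩

/-- Equality of the laws of `f(M)` at `t₀` and `t` forces the exponents of the density ratios to
agree up to a constant. -/
theorem ae_dotProduct_stat_eq (hθ : θ.IsModel) (hinj : InjOn θ.f θ.latentSpace)
    (hθ' : θ'.IsModel) (hinj' : InjOn θ'.f θ'.latentSpace) {t₀ t : 𝒯}
    (h₀ : θ.signalLaw t₀ = θ'.signalLaw t₀) (ht : θ.signalLaw t = θ'.signalLaw t) :
    ∀ᵐ x ∂θ.imageMeasure, θ.lamDiff t₀ t ⬝ᵥ θ.stat (θ.inv x) =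
      θ'.lamDiff t₀ t ⬝ᵥ θ'.stat (θ'.inv x) +
        (Real.log (θ'.normRatio t₀ t) - Real.log (θ.normRatio t₀ t)) := by
  obtain ⟨g, hg, hgf⟩ := hθ.exists_measurable_inv hinj
  obtain ⟨g', hg', hgf'⟩ := hθ'.exists_measurable_inv hinj'
  have := hθ.isFiniteMeasure_signalLaw t₀
  rw [hθ.signalLaw_eq_withDensity hg hgf t₀ t, hθ'.signalLaw_eq_withDensity hg' hgf' t₀ t,
    ← h₀] at ht
  replace ht := (withDensity_eq_iff_of_sigmaFinite
    ((hθ.measurable_priorRatio t₀ t).comp hg).ennreal_ofReal.aemeasurable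
    ((hθ'.measurable_priorRatio t₀ t).comp hg').ennreal_ofReal.aemeasurable).1 ht
  filter_upwards [(hθ.imageMeasure_ac_signalLaw t₀).ae_le ht, ae_mem_image hθ hinj,
    (sameNullSets_of_signalLaw_eq hθ hθ' h₀).1.ae_le (ae_mem_image hθ' hinj')] with x hx hxi hxi'
  obtain ⟨m, hm, rfl⟩ := hxi
  obtain ⟨m', hm', hmm⟩ := hxi'
  rw [inv_apply hinj hm]
  rw [Function.comp_apply, Function.comp_apply, hgf m hm, ← hmm, hgf' m' hm'] at hx
  rw [← hmm, inv_apply hinj' hm']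
  have hr := hθ.normRatio_pos t₀ t
  have hr' := hθ'.normRatio_pos t₀ t
  rw [ENNReal.ofReal_eq_ofReal_iff (by unfold priorRatio; positivity)
    (by unfold priorRatio; positivity), priorRatio, priorRatio] at hx
  have := congrArg Real.log hx
  rw [Real.log_mul hr.ne' (Real.exp_ne_zero _), Real.log_mul hr'.ne' (Real.exp_ne_zero _),
    Real.log_exp, Real.log_exp] at this
  linarith

/-- An affine relation between the sufficient statistics, valid almost everywhere, has an
invertible matrix if the sufficient statistics are strongly independent. -/
theorem isUnit_of_ae_stat_eq (hθ : θ.IsModel) (hinj : InjOn θ.f θ.latentSpace)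
    (hindep : θ.StronglyIndependent) (t : 𝒯) {A : Matrix (Fin n × Fin k) (Fin n × Fin k) ℝ}
    {c : Fin n × Fin k → ℝ} {S : EuclideanSpace ℝ (Fin d) → Fin n × Fin k → ℝ}
    (h : ∀ᵐ x ∂θ.imageMeasure, θ.stat (θ.inv x) = A.mulVec (S x) + c) : IsUnit A := by
  rw [Matrix.isUnit_iff_isUnit_det, isUnit_iff_ne_zero]
  intro hdet
  -- Pairing the relation with a left null vector `w` kills `S`, whatever it is.
  obtain ⟨w, hw0, hw⟩ := Matrix.exists_vecMul_eq_zero_iff.2 hdet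
  refine hw0 (funext fun p => ?_)
  have hsum : ∀ᵐ m : Fin n → ℝ, (∀ i, m i ∈ θ.latentAxis i) →
      ∑ i, ∑ j, w (i, j) * θ.H i j (m i) = w ⬝ᵥ c := by
    have h1 := (ae_restrict_iff' hθ.measurableSet_latentSpace).1
      (ae_of_ae_map hθ.measurable_f.aemeasurable h)
    filter_upwards [h1] with m hm hmem
    have h2 := congrArg (w ⬝ᵥ ·) (hm hmem)
    simp only [inv_apply hinj hmem, dotProduct_add, Matrix.dotProduct_mulVec, hw,
      zero_dotProduct, zero_add] at h2
    rw [← h2, dotProduct, Fintype.sum_prod_type]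
    rfl
  obtain ⟨c', hc'⟩ := ae_const_of_ae_sum_const (h := fun i s => ∑ j, w (i, j) * θ.H i j s)
    (fun i => hθ.volume_latentAxis_ne_zero t i) hsum p.1
  have hmeas : Measurable fun s => ∑ j, w (p.1, j) * θ.H p.1 j s := by
    have := hθ.measurable_H p.1
    fun_prop
  -- This set fills the axis up to a null set, hence has positive measure.
  have hw1 := hindep p.1 {s ∈ θ.latentAxis p.1 | ∑ j, w (p.1, j) * θ.H p.1 j s = c'}
    (fun s hs => hs.1)
    ((hθ.measurableSet_latentAxis p.1).inter (hmeas (measurableSet_singleton c')))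
    (by
      refine (pos_iff_ne_zero.2 (hθ.volume_latentAxis_ne_zero t p.1)).trans_le
        (measure_mono_ae ?_)
      filter_upwards [hc'] with s hs hmem using ⟨hmem, hs hmem⟩)
    (fun j => w (p.1, j)) c' fun s hs => hs.2
  exact congrFun hw1 p.2

theorem equivA_of_signalLaw_eq (hθ : θ.IsModel) (hinj : InjOn θ.f θ.latentSpace)
    (hθ' : θ'.IsModel) (hinj' : InjOn θ'.f θ'.latentSpace) (hindep : θ.StronglyIndependent)
    {T : Fin (n * k + 1) → 𝒯} (hT : IsUnit (θ.lamMatrix T))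
    (h : ∀ t, θ.signalLaw t = θ'.signalLaw t) : EquivA θ θ' := by
  -- After transposition, row `l` is `lamDiff` between `T 0` and `T (l + 1)`, so the scalar
  -- equations become one matrix equation.
  set L := (θ.lamMatrix T).transpose with hL
  set L' := (θ'.lamMatrix T).transpose with hL'
  have hLdet : IsUnit L.det := by
    rwa [hL, Matrix.det_transpose, ← Matrix.isUnit_iff_isUnit_det]
  let b : Fin n × Fin k → ℝ := fun l =>
    Real.log (θ'.normRatio (T 0) (T (finProdFinEquiv l).succ)) -
      Real.log (θ.normRatio (T 0) (T (finProdFinEquiv l).succ))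
  have hae : ∀ᵐ x ∂θ.imageMeasure,
      θ.stat (θ.inv x) = (L⁻¹ * L').mulVec (θ'.stat (θ'.inv x)) + L⁻¹.mulVec b := by
    have h1 := ae_all_iff.2 fun l : Fin n × Fin k =>
      ae_dotProduct_stat_eq hθ hinj hθ' hinj' (h (T 0)) (h (T (finProdFinEquiv l).succ))
    filter_upwards [h1] with x hx
    have hlin : L.mulVec (θ.stat (θ.inv x)) = L'.mulVec (θ'.stat (θ'.inv x)) + b := funext hx
    rw [← Matrix.mulVec_mulVec, ← Matrix.mulVec_add, ← hlin, Matrix.mulVec_mulVec,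
      Matrix.nonsing_inv_mul _ hLdet, Matrix.one_mulVec]
  exact ⟨sameNullSets_of_signalLaw_eq hθ hθ' (h (T 0)), _, _,
    isUnit_of_ae_stat_eq hθ hinj hindep (T 0) hae, hae⟩

/-! ### Regular parameters: from almost every point to every point -/

theorem Regular.continuousOn_stat_inv (hr : θ.Regular) :
    ContinuousOn (fun x => θ.stat (θ.inv x)) θ.image :=
  continuousOn_pi.2 fun p => (hr.continuousOn_H p.1 p.2).comp
    (f := fun x => θ.inv x p.1)
    ((continuous_apply p.1).comp_continuousOn hr.continuousOn_inv) fun _ hx => inv_mem hx p.1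

/-- Every neighbourhood of a point of the image of a regular parameter has positive measure. -/
theorem Regular.imageMeasure_ne_zero (hr : θ.Regular) (hθ : θ.IsModel)
    {x : EuclideanSpace ℝ (Fin d)} (hx : x ∈ θ.image) {U : Set (EuclideanSpace ℝ (Fin d))}
    (hU : IsOpen U) (hxU : x ∈ U) : θ.imageMeasure U ≠ 0 := by
  obtain ⟨m, hm, rfl⟩ := hx
  rw [imageMeasure, Measure.map_apply hθ.measurable_f hU.measurableSet,
    Measure.restrict_apply (hθ.measurable_f hU.measurableSet), inter_comm]
  exact ((hr.continuousOn_f.isOpen_inter_preimage hr.isOpen_latentSpace hU).measure_pos volume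
    ⟨m, hm, hxU⟩).ne'

/-- The good points form a set of full measure and every neighbourhood of an image point has
positive measure, so they accumulate at each point of both images, where both sides are continuous.
-/
theorem EquivA.strictEquivA (h : EquivA θ θ') (hθ : θ.IsModel)
    (hinj : InjOn θ.f θ.latentSpace) (hθ' : θ'.IsModel) (hinj' : InjOn θ'.f θ'.latentSpace)
    (hr : θ.Regular) (hr' : θ'.Regular) : StrictEquivA θ θ' := by
  obtain ⟨hnull, A, c, hA, hae⟩ := h
  refine ⟨hnull, A, c, hA, fun x hx => ?_⟩
  let F := fun x => θ.stat (θ.inv x)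
  let F' := fun x => A.mulVec (θ'.stat (θ'.inv x)) + c
  -- Membership in both images is part of `G`, because each side is continuous only along its own
  -- image.
  let G := {y | y ∈ θ.image ∧ y ∈ θ'.image ∧ F y = F' y}
  have hG : ∀ᵐ y ∂θ.imageMeasure, y ∈ G := by
    filter_upwards [hae, ae_mem_image hθ hinj, hnull.1.ae_le (ae_mem_image hθ' hinj')]
      with y h1 h2 h3 using ⟨h2, h3, h1⟩
  have hcl : x ∈ closure G := by
    refine mem_closure_iff.2 fun U hU hxU => ?_
    exact ((frequently_ae_mem_iff.2 (hr.imageMeasure_ne_zero hθ hx.1 hU hxU)).and_eventually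
      hG).exists
  have hF : Filter.Tendsto F (nhdsWithin x G) (nhds (F x)) :=
    (hr.continuousOn_stat_inv x hx.1).mono fun y hy => hy.1
  have hF' : Filter.Tendsto F' (nhdsWithin x G) (nhds (F' x)) := by
    have h1 : ContinuousOn F' θ'.image :=
      (((Continuous.matrix_mulVec continuous_const continuous_id).comp_continuousOn
        hr'.continuousOn_stat_inv).add continuousOn_const)
    exact (h1 x hx.2).mono fun y hy => hy.2.1
  have := mem_closure_iff_nhdsWithin_neBot.1 hcl
  refine tendsto_nhds_unique hF (hF'.congr' ?_)
  filter_upwards [self_mem_nhdsWithin] with y hy using hy.2.2.symm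

end Params

theorem theorem1 {n k d : ℕ} {𝒯 : Type*}
    (pε : EuclideanSpace ℝ (Fin d) → ℝ) (hpε : IsProbDensity pε)
    (θ : Params n k d 𝒯) (hθ : θ.IsModel)
    (hinj : Set.InjOn θ.f θ.latentSpace)
    (hchar : MeasureTheory.volume {x | noiseCharFun pε x = 0} = 0)
    (hdiff : ∀ i j, ∀ᵐ s, s ∈ θ.latentAxis i → DifferentiableAt ℝ (θ.H i j) s)
    (hindep : θ.StronglyIndependent)
    (hlam : ∃ T : Fin (n * k + 1) → 𝒯, Function.Injective T ∧ IsUnit (θ.lamMatrix T)) :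
    Params.IdentifiableUpTo pε (Params.admissible n k d 𝒯) Params.EquivA θ ∧
      (θ.Regular →
        Params.IdentifiableUpTo pε {θ' | θ' ∈ Params.admissible n k d 𝒯 ∧ θ'.Regular}
          Params.StrictEquivA θ) := by
  obtain ⟨T, -, hT⟩ := hlam
  have hA : Params.IdentifiableUpTo pε (Params.admissible n k d 𝒯) Params.EquivA θ :=
    fun θ' hθ' h => Params.equivA_of_signalLaw_eq hθ hinj hθ'.1 hθ'.2 hindep hT
      (h.signalLaw_eq hpε hchar hθ hθ'.1)
  exact ⟨hA, fun hr θ' hθ' h =>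
    (hA θ' hθ'.1 h).strictEquivA hθ hinj hθ'.1.1 hθ'.1.2 hr hθ'.2⟩
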